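/- Let $(m_i)_{i\ge 1}$ be a sequence of integers with $m_i\ge 2$ such that $m_{i+1}$ is a multiple of $m_i$ for all $i\ge 1$. Let $\Omega=\prod_{i\ge1}\mathbb Z/m_i\mathbb Z$ with its Borel $\sigma$-algebra, and let $\mathfrak t:\Omega\to\Omega$ be the diagonal translation $\mathfrak t(x)=(x_i+1)_{i\ge 1}$. Given probability measures $\mu_i$ on $\mathbb Z/m_i\mathbb Z$, let $\mu=\bigotimes_{i\ge1}\mu_i$; call $(\mu_i)$ admissible if $\mu_i(\{j\})>0$ for all $i$ and all $j\in\mathbb Z/m_i\mathbb Z$, and $\mu(\{x\})=0$ for all $x\in\Omega$. Let $C_{\mathfrak t}f=f\circ\mathfrak t$. (a) If $m_i\to\infty$, there is an admissible sequence $(\mu_i)$ such that $\mathfrak t$ is nonsingular with respect to $\mu$ (i.e. $\mu(B)=0$ implies $\mu(\mathfrak t^{-1}(B))=0$) and, for every $1\le p<\infty$, $C_{\mathfrak t}$ is a bounded operator on the complex space $L_p(\Omega,\mu)$ which is frequently hypercyclic: there is $f\in L_p(\Omega,\mu)$ such that for every nonempty open set $V\subset L_p(\Omega,\mu)$, the set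 $\{n: C_{\mathfrak t}^nf\in V\}$ has positive lower density. (b) If the sequence $(m_{i+1}/m_i)$ is unbounded, there is an admissible sequence $(\mu_i)$ such that $\mathfrak t$ is nonsingular with respect to $\mu$ and, for every $1\le p<\infty$, $C_{\mathfrak t}$ is a bounded operator on the complex space $L_p(\Omega,\mu)$ which is frequently hypercyclic and topologically rigid along $(m_i)$, i.e. $C_{\mathfrak t}^{m_i}f\to f$ in $L_p(\Omega,\mu)$ for all $f\in L_p(\Omega,\mu)$. In particular, $C_{\mathfrak t}$ is chaotic (it has a dense orbit, and its periodic points are dense) but it is not topologically mixing (i.e. it is not true that for all nonempty open sets $U,V\subset L_p(\Omega,\mu)$ one has $C_{\mathfrak t}^n(U)\cap V\ne\varnothing$ for all large enough $n$). -/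

import Mathlib

open MeasureTheory Filter Topology
open scoped ENNReal

/-- The lower (asymptotic) density `liminf_{N → ∞} #(A ∩ {1, …, N}) / N` of a set of natural
numbers. The quotients lie in `[0, 1]`, so the real `liminf` is the usual one. -/
noncomputable def lowerDensity (A : Set ℕ) : ℝ :=
  liminf (fun N : ℕ => ((A ∩ Set.Icc 1 N).ncard : ℝ) / (N : ℝ)) atTop

section LinearDynamics

variable {X : Type*} [NormedAddCommGroup X] [NormedSpace ℂ X]

/-- `T` is hypercyclic: some vector has a dense orbit `{T ^ n x : n ≥ 0}`. -/
def IsHypercyclic (T : X →L[ℂ] X) : Prop :=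
  ∃ x : X, Dense (Set.range fun n : ℕ => (T ^ n) x)

/-- `T` is chaotic: it is hypercyclic and its periodic points (the vectors `u` such that
`T ^ d u = u` for some `d ≥ 1`) are dense. -/
def IsChaotic (T : X →L[ℂ] X) : Prop :=
  IsHypercyclic T ∧ Dense {u : X | ∃ d : ℕ, 1 ≤ d ∧ (T ^ d) u = u}

/-- `T` is frequently hypercyclic: there is a vector `x` such that, for every nonempty open set
`V`, the set of all `n` with `T ^ n x ∈ V` has positive lower density. -/
def IsFrequentlyHypercyclic (T : X →L[ℂ] X) : Prop :=
  ∃ x : X, ∀ V : Set X, IsOpen V → V.Nonempty → 0 < lowerDensity {n : ℕ | (T ^ n) x ∈ V}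

/-- `T` is topologically mixing: for all nonempty open sets `U`, `V`, one has
`T ^ n (U) ∩ V ≠ ∅` for all large enough `n`. -/
def IsTopologicallyMixing (T : X →L[ℂ] X) : Prop :=
  ∀ U V : Set X, IsOpen U → IsOpen V → U.Nonempty → V.Nonempty →
    ∃ n₀ : ℕ, ∀ n ≥ n₀, (((T ^ n) '' U) ∩ V).Nonempty

/-- `T` is topologically rigid along the sequence `m`: `T ^ (m i) f → f` for every `f`. -/
def IsTopologicallyRigidAlong (T : X →L[ℂ] X) (m : ℕ → ℕ) : Prop :=
  ∀ f : X, Tendsto (fun i : ℕ => (T ^ (m i)) f) atTop (𝓝 f)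

end LinearDynamics

/-- The bounded operator `T` on `L^p(μ)` is the composition operator `C_φ : f ↦ f ∘ φ`: the map `φ`
is measurable and nonsingular (`μ(B) = 0` implies `μ(φ⁻¹ B) = 0`), and `T f` is the class of
`f ∘ φ` for every `f` in `L^p(μ)`. Such a `T` exists exactly when `C_φ` is well defined and bounded
on `L^p(μ)`, and it is then unique. -/
def IsCompositionOperator {Ω : Type*} [MeasurableSpace Ω] {μ : Measure Ω} {p : ℝ≥0∞}
    [Fact (1 ≤ p)] (φ : Ω → Ω) (T : Lp ℂ p μ →L[ℂ] Lp ℂ p μ) : Prop :=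
  ∃ hφ : Measure.QuasiMeasurePreserving φ μ μ,
    ∀ f : Lp ℂ p μ, (T f : Ω →ₘ[μ] ℂ) = (f : Ω →ₘ[μ] ℂ).compQuasiMeasurePreserving φ hφ

/-- The diagonal translation `x ↦ x + (1, 1, 1, …)` on `∏ i, ℤ/m_iℤ`, for coordinatewise
addition. -/
def diagonalTranslation (m : ℕ → ℕ) (x : ∀ i, ZMod (m i)) : ∀ i, ZMod (m i) :=
  fun i => x i + 1

/-! ### Frequent hypercyclicity from approximation by periodic vectors. -/

section FrequentHypercyclicityCriterion

/-! Give the `i`-th factor weights proportional to `b i ^ (-|y|)`, where `|y|` is the distance from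
`y` to `0` on the circle `ZMod (m i)`. Translation by `n` distorts this measure by a factor at most
`b i ^ n` (`map_add_circularMeasure_singleton_le`). If `∑ (b i - 1)` converges, the distortions for
`n = 1` multiply to a finite constant, and `Measure.infinitePi_le_smul` bounds the composition
operator. Still, `(b l - 1) * m l` can be huge for suitable `l`, and then the `l`-th factor gives
little mass to points far from `0` (`circularMeasure_real_le`). Having `b i = 1` infinitely often
excludes atoms.

Functions of finitely many coordinates are dense, and those of the coordinates up to `i` are fixed
by `T ^ m i`. Restrict such an `f` to the points whose `l`-th coordinate is far from `0`: the result
has small norm, stays small for a time proportional to `m l`, and, once the translation has carried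
the bulk of the mass to the far side of the circle, imitates the orbit of `f` for an equally long
time. A series of such periodic blocks is a frequently hypercyclic vector
(`isFrequentlyHypercyclic_of_periodic_approximation`).

For (b), take `b i - 1 = g i / m (i - 1)` with `g` summable. Translation by `m k` fixes the
coordinates up to `k` and distorts each later one by at most `exp (g i)`, so the powers `T ^ m k`
are uniformly bounded. This gives rigidity and excludes mixing; chaos follows from hypercyclicity
and the dense periodic functions. -/

theorem Nat.count_mul_of_periodic {p : ℕ → Prop} [DecidablePred p] {D : ℕ}
    (hp : ∀ n, p (D + n) ↔ p n) (s : ℕ) :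
    Nat.count p (D * s) = s * Nat.count p D := by
  induction s with
  | zero => simp
  | succ s ih =>
    rw [Nat.mul_succ, add_comm, Nat.count_add]
    simp only [hp, ih]
    ring

open Classical in
theorem lowerDensity_pos_of_le_count {A : Set ℕ} {c N₀ : ℕ} (hc : 0 < c)
    (h : ∀ N ≥ N₀, ∃ M ≤ N, N ≤ c * Nat.count (· ∈ A) M) : 0 < lowerDensity A := by
  have hc' : (0 : ℝ) < c := by exact_mod_cast hc
  have key : ∀ᶠ N : ℕ in atTop,
      (1 / (2 * c) : ℝ) ≤ ((A ∩ Set.Icc 1 N).ncard : ℝ) / (N : ℝ) := by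
    filter_upwards [eventually_ge_atTop (max N₀ (2 * c + 1))] with N hN
    obtain ⟨M, hMN, hM⟩ := h N (le_trans (le_max_left _ _) hN)
    have h2 : 2 * c + 1 ≤ N := le_trans (le_max_right _ _) hN
    -- `Nat.count` looks at `0, …, M - 1` and the density at `1, …, N`; the extra `1` pays for the
    -- time `0`.
    have hle : Nat.count (· ∈ A) M ≤ (A ∩ Set.Icc 1 N).ncard + 1 := by
      rw [Nat.count_eq_card_filter_range, ← Set.ncard_coe_finset]
      have hfin : (A ∩ Set.Icc 1 N).Finite := (Set.finite_Icc 1 N).inter_of_right A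
      refine le_trans (Set.ncard_le_ncard (t := insert 0 (A ∩ Set.Icc 1 N)) ?_ (hfin.insert 0))
        (Set.ncard_insert_le _ _)
      intro n hn
      simp only [Finset.coe_filter, Finset.mem_range, Set.mem_ofPred_eq] at hn
      rcases Nat.eq_zero_or_pos n with h0 | h0
      · exact Or.inl h0
      · exact Or.inr ⟨hn.2, h0, by omega⟩
    have h3 : (N : ℝ) ≤ c * ((A ∩ Set.Icc 1 N).ncard + 1) := by
      exact_mod_cast hM.trans (Nat.mul_le_mul_left c hle)
    have h4 : (2 * c + 1 : ℝ) ≤ N := by exact_mod_cast h2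
    have h5 : (0 : ℝ) < N := by linarith
    rw [div_le_div_iff₀ (by positivity) h5]
    nlinarith
  have hb : IsCoboundedUnder (· ≥ ·) atTop
      (fun N : ℕ => ((A ∩ Set.Icc 1 N).ncard : ℝ) / (N : ℝ)) := by
    refine IsBoundedUnder.isCoboundedUnder_ge ⟨1, ?_⟩
    simp only [eventually_map]
    filter_upwards with N
    refine div_le_one_of_le₀ ?_ (Nat.cast_nonneg _)
    have := Set.ncard_le_ncard (Set.inter_subset_right : A ∩ Set.Icc 1 N ⊆ _) (Set.finite_Icc 1 N)
    rw [Set.ncard_eq_toFinset_card' (Set.Icc 1 N)] at this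
    simp at this
    exact_mod_cast this
  exact lt_of_lt_of_le (by positivity) (le_liminf_of_le hb key)

/-- The 2-adic valuation of `k + 1` works: it equals `l` exactly at the odd multiples of `2 ^ l`,
which recur with period `2 * 2 ^ l`. -/
theorem exists_nat_seq_bounded_gaps :
    ∃ ℓ : ℕ → ℕ, ∀ l, ∃ G, ∀ k, ∃ k', k ≤ k' ∧ k' < k + G ∧ ℓ k' = l := by
  refine ⟨fun k => padicValNat 2 (k + 1), fun l => ⟨2 * 2 ^ l + 2 ^ l, fun k => ?_⟩⟩
  have hpos : 0 < 2 ^ l := by positivity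
  set t := (k + 1) / (2 * 2 ^ l)
  have h1 := Nat.div_add_mod (k + 1) (2 * 2 ^ l)
  have h2 := Nat.mod_lt (k + 1) (show 0 < 2 * 2 ^ l by positivity)
  change 2 * 2 ^ l * t + _ = _ at h1
  by_cases hlt : (k + 1) % (2 * 2 ^ l) ≤ 2 ^ l
  · have e : 2 ^ l * (2 * t + 1) = 2 * 2 ^ l * t + 2 ^ l := by ring
    refine ⟨2 ^ l * (2 * t + 1) - 1, by omega, by omega, ?_⟩
    have : 2 ^ l * (2 * t + 1) - 1 + 1 = 2 ^ l * (2 * t + 1) := by omega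
    simp only [this]
    rw [padicValNat.mul (by positivity) (by positivity), padicValNat.prime_pow,
      padicValNat.eq_zero_of_not_dvd (by omega), add_zero]
  · have e : 2 ^ l * (2 * t + 3) = 2 * 2 ^ l * t + 2 ^ l + 2 * 2 ^ l := by ring
    refine ⟨2 ^ l * (2 * t + 3) - 1, by omega, by omega, ?_⟩
    have : 2 ^ l * (2 * t + 3) - 1 + 1 = 2 ^ l * (2 * t + 3) := by omega
    simp only [this]
    rw [padicValNat.mul (by positivity) (by positivity), padicValNat.prime_pow,
      padicValNat.eq_zero_of_not_dvd (by omega), add_zero]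

variable {X : Type*} [NormedAddCommGroup X] [NormedSpace ℂ X]

theorem ContinuousLinearMap.pow_mul_apply_of_periodic {T : X →L[ℂ] X} {y : X} {D : ℕ}
    (hy : (T ^ D) y = y) (s : ℕ) : (T ^ (D * s)) y = y := by
  induction s with
  | zero => simp
  | succ s ih => rw [Nat.mul_succ, pow_add, mul_apply_eq_comp, hy, ih]

theorem ContinuousLinearMap.pow_apply_of_dvd {T : X →L[ℂ] X} {y : X} {D n : ℕ}
    (hy : (T ^ D) y = y) (h : D ∣ n) : (T ^ n) y = y := by
  obtain ⟨s, rfl⟩ := h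
  exact pow_mul_apply_of_periodic hy s

open Classical in
/-- Sum of a sequence of increasingly long periodic blocks: the `k`-th block `y (k + 1) - y k` is
small during the first `q k` iterates, and brings the orbit close to `x (ℓ k)` after `n k`
iterates, at every multiple of `d (ℓ k)` below `q k`. -/
theorem isFrequentlyHypercyclic_of_periodic_blocks [CompleteSpace X] (T : X →L[ℂ] X)
    (x : ℕ → X) (hx : DenseRange x) (d : ℕ → ℕ) (hd : ∀ l, 0 < d l)
    (ℓ : ℕ → ℕ) (hℓ : ∀ l, ∃ G, ∀ k, ∃ k', k ≤ k' ∧ k' < k + G ∧ ℓ k' = l)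
    (y : ℕ → X) (D n q : ℕ → ℕ) (a : ℕ)
    (hD : ∀ k, 0 < D k) (hy : ∀ k, (T ^ D k) (y k) = y k)
    (hDq : ∀ k, D k ∣ q k) (hdq : ∀ k, d (ℓ k) ∣ q k) (hq : ∀ k, 0 < q k)
    (hqn : ∀ k, q k ≤ n k) (hnq : ∀ k, n k + q k ≤ D (k + 1)) (haq : ∀ k, D (k + 1) ≤ a * q k)
    (hsmall : ∀ k, ∀ t < q k, ‖(T ^ t) (y (k + 1) - y k)‖ ≤ (1 / 2) ^ k)
    (hclose : ∀ k, ∀ t < q k, d (ℓ k) ∣ t →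
      ‖(T ^ (n k + t)) (y (k + 1)) - x (ℓ k)‖ ≤ (1 / 2) ^ k) :
    IsFrequentlyHypercyclic T := by
  have hdist : ∀ k, ∀ t < q k, dist ((T ^ t) (y k)) ((T ^ t) (y (k + 1))) ≤ (1 / 2) ^ k := by
    intro k t ht
    rw [dist_comm, dist_eq_norm, ← map_sub]
    exact hsmall k t ht
  have hqle : ∀ k, 2 * q k ≤ D (k + 1) := fun k => by have := hqn k; have := hnq k; omega
  have hDle : ∀ k, D k ≤ q k := fun k => Nat.le_of_dvd (hq k) (hDq k)
  have hqmono : Monotone q := monotone_nat_of_le_succ fun k => by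
    have := hqle k; have := hDle (k + 1); omega
  have hDmono : StrictMono D := strictMono_nat_of_lt_succ fun k => by
    have := hqle k; have := hDle k; have := hq k; omega
  have ha : 0 < a := Nat.pos_of_ne_zero fun h => by
    have := haq 0; have := hD 1; simp_all
  obtain ⟨u, hu⟩ : ∃ u, Tendsto y atTop (𝓝 u) := by
    refine cauchySeq_tendsto_of_complete
      (cauchySeq_of_le_geometric (1 / 2) 1 (by norm_num) fun k => ?_)
    simpa using hdist k 0 (hq k)
  have htail : ∀ k, ∀ t < q k, dist ((T ^ t) (y k)) ((T ^ t) u) ≤ 2 * (1 / 2) ^ k := by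
    intro k t ht
    have hlim : Tendsto (fun j => (T ^ t) (y (k + j))) atTop (𝓝 ((T ^ t) u)) := by
      refine ((T ^ t).continuous.tendsto u).comp (hu.comp ?_)
      simpa [add_comm] using tendsto_add_atTop_nat k
    have := dist_le_of_le_geometric_of_tendsto₀ (1 / 2) ((1 / 2) ^ k) (by norm_num)
      (fun j => by
        rw [← pow_add]
        exact hdist (k + j) t (lt_of_lt_of_le ht (hqmono (Nat.le_add_right k j)))) hlim
    simp only [add_zero] at this
    refine this.trans (le_of_eq ?_)
    ring
  have hper : ∀ k (z : X) (δ : ℝ) m, ‖(T ^ (D k + m)) (y k) - z‖ ≤ δ ↔ ‖(T ^ m) (y k) - z‖ ≤ δ := by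
    intro k z δ m
    rw [add_comm, pow_add, mul_apply_eq_comp, hy]
  -- proportion of time that the `(K + 1 + j)`-th partial sum spends near `x (ℓ K)`
  have hcount : ∀ K j, ∀ M, D (K + 1 + j) ∣ M → M ≤ (a ^ (j + 1) * d (ℓ K)) *
      Nat.count (fun m => ‖(T ^ m) (y (K + 1 + j)) - x (ℓ K)‖ ≤
        ∑ i ∈ Finset.range (j + 1), (1 / 2 : ℝ) ^ (K + i)) M := by
    intro K j
    suffices hs : D (K + 1 + j) ≤ (a ^ (j + 1) * d (ℓ K)) *
      Nat.count (fun m => ‖(T ^ m) (y (K + 1 + j)) - x (ℓ K)‖ ≤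
        ∑ i ∈ Finset.range (j + 1), (1 / 2 : ℝ) ^ (K + i)) (D (K + 1 + j)) by
      rintro M ⟨s, rfl⟩
      rw [Nat.count_mul_of_periodic (hper _ _ _)]
      calc _ ≤ ((a ^ (j + 1) * d (ℓ K)) * _) * s := Nat.mul_le_mul_right s hs
        _ = _ := by ring
    induction j with
    | zero =>
      -- The window of length `q K` after time `n K` fills at least `1 / a` of the period `D (K +
      -- 1)`, and one time in `d (ℓ K)` in it is good.
      simp only [add_zero, zero_add, pow_one, Finset.sum_range_one]
      refine (haq K).trans ?_
      rw [mul_assoc]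
      refine Nat.mul_le_mul_left a ?_
      refine le_trans ?_ (Nat.mul_le_mul_left _ (Nat.count_monotone _ (hnq K)))
      rw [Nat.count_add]
      refine le_trans ?_ (Nat.mul_le_mul_left _ (Nat.le_add_left _ _))
      refine le_trans ?_ (Nat.mul_le_mul_left _ (Nat.count_mono_left (hclose K)))
      obtain ⟨s, hs⟩ := hdq K
      rw [hs, Nat.count_mul_of_periodic (p := (d (ℓ K) ∣ ·))
        (fun m => Nat.dvd_add_right (dvd_refl _))]
      refine Nat.mul_le_mul_left _ (Nat.le_mul_of_pos_right _ ?_)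
      exact lt_of_lt_of_le (by simp [Nat.count_one]) (Nat.count_monotone _ (hd (ℓ K)))
    | succ j ih =>
      -- Passing to the next partial sum: up to time `q` the new orbit follows the old periodic one,
      -- and `q` is at least `1 / a` of the new period. So the proportion drops by a factor `a` at
      -- most.
      have h1 : q (K + 1 + j) ≤ (a ^ (j + 1) * d (ℓ K)) *
          Nat.count (fun m => ‖(T ^ m) (y (K + 1 + j)) - x (ℓ K)‖ ≤
            ∑ i ∈ Finset.range (j + 1), (1 / 2 : ℝ) ^ (K + i)) (q (K + 1 + j)) := by
        obtain ⟨s, hs⟩ := hDq (K + 1 + j)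
        rw [hs, Nat.count_mul_of_periodic (hper _ _ _)]
        calc _ ≤ ((a ^ (j + 1) * d (ℓ K)) * _) * s := Nat.mul_le_mul_right s ih
          _ = _ := by ring
      refine (haq (K + 1 + j)).trans ((Nat.mul_le_mul_left a h1).trans ?_)
      rw [← mul_assoc, ← mul_assoc, ← pow_succ']
      refine Nat.mul_le_mul_left _ ?_
      refine (Nat.count_mono_left fun t ht h => ?_).trans (Nat.count_monotone _ ?_)
      · have h2 := hdist _ t ht
        rw [dist_comm, dist_eq_norm] at h2
        rw [Finset.sum_range_succ _ (j + 1)]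
        have h3 : (T ^ t) (y (K + 1 + (j + 1))) - x (ℓ K) =
          ((T ^ t) (y (K + 1 + j)) - x (ℓ K)) +
            ((T ^ t) (y (K + 1 + j + 1)) - (T ^ t) (y (K + 1 + j))) := by
          rw [← add_assoc]; abel
        rw [h3]
        refine (norm_add_le _ _).trans (add_le_add h ?_)
        rwa [show K + (j + 1) = K + 1 + j by ring]
      · have := hqle (K + 1 + j)
        rw [← add_assoc]; omega
  refine ⟨u, fun V hV hne => ?_⟩
  obtain ⟨l, hl⟩ := hx.exists_mem_open hV hne
  obtain ⟨δ, hδ, hball⟩ := Metric.isOpen_iff.1 hV _ hl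
  obtain ⟨G, hG⟩ := hℓ l
  obtain ⟨K₀, hK₀⟩ := exists_pow_lt_of_lt_one (show 0 < δ / 4 by linarith)
    (show (1 / 2 : ℝ) < 1 by norm_num)
  have hGpos : 0 < G := by obtain ⟨k', h1, h2, -⟩ := hG 0; omega
  refine lowerDensity_pos_of_le_count (c := 2 * a * (a ^ G * d l)) (N₀ := D (K₀ + G))
    (by have := hd l; positivity) fun N hN => ?_
  obtain ⟨k, hkN, hNk⟩ : ∃ k, D k ≤ N ∧ N < D (k + 1) := by
    have hex : ∃ k, N < D k := ⟨N + 1, lt_of_lt_of_le (Nat.lt_succ_self N) (hDmono.id_le (N + 1))⟩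
    have h0 : Nat.find hex ≠ 0 := fun h => by
      have h1 := Nat.find_spec hex
      rw [h] at h1
      have := hDmono.monotone (Nat.zero_le (K₀ + G)); omega
    refine ⟨Nat.find hex - 1, not_lt.1 (Nat.find_min hex (by omega)), ?_⟩
    rw [Nat.sub_add_cancel (by omega)]
    exact Nat.find_spec hex
  have hk : K₀ + G ≤ k := by
    by_contra h
    have := hDmono.monotone (show k + 1 ≤ K₀ + G by omega); omega
  -- The target `l` was treated at most `G` steps before `k`, so at most `G` factors `a` are lost, a
  -- bound independent of `N`.
  obtain ⟨K, hK1, hK2, rfl⟩ := hG (k - G)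
  obtain ⟨j, rfl⟩ : ∃ j, k = K + 1 + j := ⟨k - (K + 1), by omega⟩
  set k := K + 1 + j
  -- The orbit of `u` follows that of `y k` only before time `q k`. Stopping there costs a factor
  -- `a`, and rounding down to a multiple of the period `D k` a factor `2`.
  set R := min N (q k)
  have hDR : D k ≤ R := le_min hkN (hDle k)
  have hNR : N ≤ a * R := by
    rcases le_total N (q k) with h | h
    · simp only [R, min_eq_left h]; exact Nat.le_mul_of_pos_left _ ha
    · simp only [R, min_eq_right h]; exact hNk.le.trans (haq k)
  have hdm := Nat.div_add_mod R (D k)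
  have hml := Nat.mod_lt R (hD k)
  have hdp : 1 ≤ R / D k := Nat.div_pos hDR (hD k)
  have hRD : R ≤ 2 * (D k * (R / D k)) := by nlinarith
  refine ⟨D k * (R / D k), (Nat.mul_div_le R (D k)).trans (min_le_left _ _), ?_⟩
  have hc := hcount K j (D k * (R / D k)) (dvd_mul_right _ _)
  have hmono : Nat.count (fun m => ‖(T ^ m) (y (K + 1 + j)) - x (ℓ K)‖ ≤
        ∑ i ∈ Finset.range (j + 1), (1 / 2 : ℝ) ^ (K + i)) (D k * (R / D k)) ≤
      Nat.count (· ∈ {n : ℕ | (T ^ n) u ∈ V}) (D k * (R / D k)) := by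
    refine Nat.count_mono_left fun t ht h => ?_
    have htq : t < q k :=
      lt_of_lt_of_le ht ((Nat.mul_div_le R (D k)).trans (min_le_right _ _))
    have h2 := htail k t htq
    refine hball ?_
    rw [Metric.mem_ball]
    rw [← dist_eq_norm] at h
    have hsum : ∑ i ∈ Finset.range (j + 1), (1 / 2 : ℝ) ^ (K + i) + 2 * (1 / 2) ^ k =
        2 * (1 / 2) ^ K := by
      simp only [pow_add, ← Finset.mul_sum, k]
      rw [geom_sum_eq (by norm_num)]
      ring
    have hK₀K : (1 / 2 : ℝ) ^ K ≤ (1 / 2) ^ K₀ :=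
      pow_le_pow_of_le_one (by norm_num) (by norm_num) (by omega)
    have := dist_triangle_left ((T ^ t) u) (x (ℓ K)) ((T ^ t) (y k))
    have h' : dist ((T ^ t) (y k)) (x (ℓ K)) ≤ _ := h
    linarith
  have hpw : a ^ (j + 1) ≤ a ^ G := Nat.pow_le_pow_right ha (by omega)
  calc N ≤ a * R := hNR
    _ ≤ a * (2 * (a ^ (j + 1) * d (ℓ K) * Nat.count _ (D k * (R / D k)))) :=
        Nat.mul_le_mul_left _ (hRD.trans (Nat.mul_le_mul_left 2 hc))
    _ ≤ a * (2 * (a ^ G * d (ℓ K) * Nat.count (· ∈ {n : ℕ | (T ^ n) u ∈ V}) (D k * (R / D k)))) := by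
        gcongr
    _ = _ := by ring

/-- The blocks are built recursively by applying `happ` to the difference between the next target
and the current partial sum `y`. Since `y` is fixed by `T ^ n`, adding `z` changes `T ^ t y` at time
`n + t` into nearly `T ^ t` of the target, which is the target itself when its period divides `t`.
-/
theorem isFrequentlyHypercyclic_of_periodic_approximation [CompleteSpace X]
    [SecondCountableTopology X] (T : X →L[ℂ] X) (m : ℕ → ℕ) (hm : ∀ i, 0 < m i)
    (hdvd : ∀ i j, i ≤ j → m i ∣ m j) (P : ℕ → AddSubgroup X) (hP : Monotone P)
    (hper : ∀ i, ∀ x ∈ P i, (T ^ m i) x = x) (hdense : Dense (⋃ i, (P i : Set X))) (a : ℕ)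
    (happ : ∀ i, ∀ x ∈ P i, ∀ ε > 0, ∃ j ≥ i, ∃ z ∈ P j, ∃ n q : ℕ, m i ∣ n ∧ m i ∣ q ∧ 0 < q ∧
      q ≤ n ∧ n + q ≤ m j ∧ m j ≤ a * q ∧ (∀ t < q, ‖(T ^ t) z‖ ≤ ε) ∧
      ∀ t < q, ‖(T ^ (n + t)) z - (T ^ t) x‖ ≤ ε) :
    IsFrequentlyHypercyclic T := by
  obtain ⟨x, κ, hx, hκ⟩ : ∃ (x : ℕ → X) (κ : ℕ → ℕ), DenseRange x ∧ ∀ l, x l ∈ P (κ l) := by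
    obtain ⟨t, hts, htc, htd⟩ := hdense.exists_countable_dense_subset
    obtain ⟨x, rfl⟩ := htc.exists_eq_range htd.nonempty
    have : ∀ l, ∃ i, x l ∈ P i := fun l => by simpa using hts ⟨l, rfl⟩
    choose κ hκ using this
    exact ⟨x, κ, htd, hκ⟩
  obtain ⟨ℓ, hℓ⟩ := exists_nat_seq_bounded_gaps
  have step : ∀ (k : ℕ) (s : {s : ℕ × X // s.2 ∈ P s.1}), ∃ (s' : {s : ℕ × X // s.2 ∈ P s.1})
      (n q : ℕ), m s.1.1 ∣ q ∧ m (κ (ℓ k)) ∣ q ∧ 0 < q ∧ q ≤ n ∧ n + q ≤ m s'.1.1 ∧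
      m s'.1.1 ≤ a * q ∧ (∀ t < q, ‖(T ^ t) (s'.1.2 - s.1.2)‖ ≤ (1 / 2) ^ k) ∧
      ∀ t < q, m (κ (ℓ k)) ∣ t → ‖(T ^ (n + t)) s'.1.2 - x (ℓ k)‖ ≤ (1 / 2) ^ k := by
    rintro k ⟨⟨i, y⟩, hy⟩
    have hxy : x (ℓ k) - y ∈ P (max i (κ (ℓ k))) :=
      (P _).sub_mem (hP (le_max_right _ _) (hκ _)) (hP (le_max_left _ _) hy)
    obtain ⟨j, hj, z, hz, n, q, h1, h2, h3, h4, h5, h6, h7, h8⟩ :=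
      happ _ _ hxy ((1 / 2) ^ k) (by positivity)
    have hi : m i ∣ m (max i (κ (ℓ k))) := hdvd _ _ (le_max_left _ _)
    have hκ' : m (κ (ℓ k)) ∣ m (max i (κ (ℓ k))) := hdvd _ _ (le_max_right _ _)
    refine ⟨⟨(j, y + z), (P j).add_mem (hP ((le_max_left _ _).trans hj) hy) hz⟩, n, q,
      hi.trans h2, hκ'.trans h2, h3, h4, h5, h6, fun t ht => by simpa using h7 t ht,
      fun t ht hdt => ?_⟩
    have e : (T ^ (n + t)) (y + z) - x (ℓ k) = (T ^ (n + t)) z - (T ^ t) (x (ℓ k) - y) := by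
      have e1 : (T ^ (n + t)) y = (T ^ t) y := by
        rw [add_comm, pow_add, mul_apply_eq_comp,
          ContinuousLinearMap.pow_apply_of_dvd (hper i y hy) (hi.trans h1)]
      have e2 : (T ^ t) (x (ℓ k)) = x (ℓ k) :=
        ContinuousLinearMap.pow_apply_of_dvd (hper _ _ (hκ _)) hdt
      rw [map_add, map_sub, e1, e2]
      abel
    simp only [e]
    exact h8 t ht
  choose next n q h1 h2 h3 h4 h5 h6 h7 h8 using step
  let s : ℕ → {s : ℕ × X // s.2 ∈ P s.1} :=
    fun k => Nat.rec ⟨(0, 0), (P 0).zero_mem⟩ next k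
  exact isFrequentlyHypercyclic_of_periodic_blocks T x hx (fun l => m (κ l)) (fun l => hm _) ℓ hℓ
    (fun k => (s k).1.2) (fun k => m (s k).1.1) (fun k => n k (s k)) (fun k => q k (s k)) a
    (fun k => hm _) (fun k => hper _ _ (s k).2) (fun k => h1 k (s k)) (fun k => h2 k (s k))
    (fun k => h3 k (s k)) (fun k => h4 k (s k)) (fun k => h5 k (s k)) (fun k => h6 k (s k))
    (fun k => h7 k (s k)) (fun k => h8 k (s k))

theorem IsFrequentlyHypercyclic.isHypercyclic {T : X →L[ℂ] X} (h : IsFrequentlyHypercyclic T) :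
    IsHypercyclic T := by
  obtain ⟨x, hx⟩ := h
  refine ⟨x, dense_iff_inter_open.2 fun V hV hne => ?_⟩
  by_contra hemp
  have hV' : {n : ℕ | (T ^ n) x ∈ V} = ∅ :=
    Set.eq_empty_of_forall_notMem fun n hn => hemp ⟨_, hn, n, rfl⟩
  have := hx V hV hne
  rw [hV'] at this
  simp [lowerDensity] at this

/-- The powers `T ^ m i` map the unit ball into the ball of radius `C`, hence never reach the open
set `C < ‖v‖`. -/
theorem not_isTopologicallyMixing_of_norm_pow_le [Nontrivial X] {T : X →L[ℂ] X} {m : ℕ → ℕ} {C : ℝ}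
    (hm : Tendsto m atTop atTop) (hC : ∀ i, ‖T ^ m i‖ ≤ C) : ¬ IsTopologicallyMixing T := by
  intro h
  have hC0 : 0 ≤ C := (norm_nonneg _).trans (hC 0)
  obtain ⟨v, hv⟩ := NormedSpace.exists_lt_norm ℂ X C
  obtain ⟨n₀, hn₀⟩ := h (Metric.ball 0 1) {v | C < ‖v‖} Metric.isOpen_ball
    (isOpen_lt continuous_const continuous_norm) ⟨0, by simp⟩ ⟨v, hv⟩
  obtain ⟨i, hi⟩ := (hm.eventually_ge_atTop n₀).exists
  obtain ⟨_, ⟨u, hu, rfl⟩, hw⟩ := hn₀ _ hi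
  have h1 : ‖(T ^ m i) u‖ ≤ C * 1 := by
    refine (ContinuousLinearMap.le_opNorm _ _).trans
      (mul_le_mul (hC i) ?_ (norm_nonneg _) hC0)
    simpa using (mem_ball_zero_iff.1 hu).le
  simp only [Set.mem_ofPred_eq] at hw
  linarith

theorem isTopologicallyRigidAlong_of_dense {T : X →L[ℂ] X} {m : ℕ → ℕ} {C : ℝ}
    (hC : ∀ i, ‖T ^ m i‖ ≤ C) {D : Set X} (hD : Dense D)
    (h : ∀ x ∈ D, ∀ᶠ i in atTop, (T ^ m i) x = x) : IsTopologicallyRigidAlong T m := by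
  intro f
  have hC0 : 0 ≤ C := (norm_nonneg _).trans (hC 0)
  rw [Metric.tendsto_atTop']
  intro ε hε
  obtain ⟨x, hx, hxf⟩ := Metric.mem_closure_iff.1 (hD f) (ε / (C + 1)) (by positivity)
  obtain ⟨N, hN⟩ := eventually_atTop.1 (h x hx)
  refine ⟨N, fun i hi => ?_⟩
  have e : (T ^ m i) f - f = (T ^ m i) (f - x) - (f - x) := by
    rw [map_sub, hN i hi.le]; abel
  rw [dist_eq_norm] at hxf ⊢
  rw [e]
  calc _ ≤ ‖(T ^ m i) (f - x)‖ + ‖f - x‖ := norm_sub_le _ _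
    _ ≤ C * ‖f - x‖ + ‖f - x‖ := by
        gcongr
        exact (ContinuousLinearMap.le_opNorm _ _).trans
          (mul_le_mul_of_nonneg_right (hC i) (norm_nonneg _))
    _ = (C + 1) * ‖f - x‖ := by ring
    _ < (C + 1) * (ε / (C + 1)) := by gcongr
    _ = ε := by field_simp

end FrequentHypercyclicityCriterion

/-! ### Domination of measures and bounded composition operators. -/

section CompositionOperators

open scoped symmDiff NNReal

variable {Ω : Type*} {mΩ : MeasurableSpace Ω}

theorem MeasureTheory.Measure.le_smul_of_isSetAlgebra {μ ν : Measure Ω} [IsFiniteMeasure μ]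
    [IsFiniteMeasure ν] {𝒜 : Set (Set Ω)} (h𝒜 : IsSetAlgebra 𝒜)
    (hgen : mΩ = MeasurableSpace.generateFrom 𝒜) {C : ℝ≥0} (h : ∀ s ∈ 𝒜, ν s ≤ C * μ s) :
    ν ≤ C • μ := by
  refine Measure.le_iff.2 fun s hs => ?_
  rw [Measure.smul_apply, ENNReal.smul_def, smul_eq_mul]
  refine ENNReal.le_of_forall_pos_le_add fun ε hε _ => ?_
  -- Approximating with respect to the sum `ν + μ` controls the error for both measures at once.
  obtain ⟨t, ht, hst⟩ := (Measure.MeasureDense.of_generateFrom_isSetAlgebra_finite (ν + μ) h𝒜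
    hgen).approx s hs (measure_ne_top _ _) (ε / (C + 1)) (by positivity)
  rw [Measure.add_apply] at hst
  set δ := ENNReal.ofReal (ε / (C + 1))
  have hδ : (C + 1 : ℝ≥0∞) * δ ≤ ε := by
    have : δ = ((ε / (C + 1) : ℝ≥0) : ℝ≥0∞) := by
      rw [← ENNReal.ofReal_coe_nnreal]; push_cast; rfl
    rw [this]
    norm_cast
    rw [mul_div_cancel₀ _ (by positivity)]
  have h1 : ν s ≤ ν t + ν (s ∆ t) :=
    (measure_mono (fun x hx => by by_cases hxt : x ∈ t <;> simp_all [Set.mem_symmDiff])).trans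
      (measure_union_le t (s ∆ t))
  have h2 : μ t ≤ μ s + μ (s ∆ t) :=
    (measure_mono (fun x hx => by by_cases hxt : x ∈ s <;> simp_all [Set.mem_symmDiff])).trans
      (measure_union_le s (s ∆ t))
  have h3 : ν (s ∆ t) ≤ δ := le_self_add.trans hst.le
  have h4 : μ (s ∆ t) ≤ δ := le_add_self.trans hst.le
  calc ν s ≤ C * μ t + δ := h1.trans (add_le_add (h t ht) h3)
    _ ≤ C * (μ s + δ) + δ := by gcongr; exact h2.trans (by gcongr)
    _ = C * μ s + (C + 1) * δ := by ring
    _ ≤ C * μ s + ε := by gcongr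

/-- Cylinders form a generating algebra, and a cylinder over finitely many finite factors is a
finite union of boxes of points, where the factorwise bounds multiply. -/
theorem MeasureTheory.Measure.infinitePi_le_smul {ι : Type*} {X : ι → Type*}
    [∀ i, MeasurableSpace (X i)] [∀ i, MeasurableSingletonClass (X i)] [∀ i, Finite (X i)]
    {μ ν : ∀ i, Measure (X i)} [∀ i, IsProbabilityMeasure (μ i)] [∀ i, IsProbabilityMeasure (ν i)]
    {c : ι → ℝ≥0} {C : ℝ≥0} (hc : ∀ i x, ν i {x} ≤ c i * μ i {x})
    (hC : ∀ s : Finset ι, ∏ i ∈ s, c i ≤ C) :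
    Measure.infinitePi ν ≤ C • Measure.infinitePi μ := by
  refine Measure.le_smul_of_isSetAlgebra isSetAlgebra_measurableCylinders
    generateFrom_measurableCylinders.symm fun A hA => ?_
  obtain ⟨s, S, hS, rfl⟩ := (mem_measurableCylinders A).1 hA
  rw [Measure.infinitePi_cylinder _ hS, Measure.infinitePi_cylinder _ hS]
  have hfin := Set.toFinite S
  rw [← hfin.coe_toFinset, ← sum_measure_singleton, ← sum_measure_singleton, Finset.mul_sum]
  refine Finset.sum_le_sum fun x _ => ?_
  rw [Measure.pi_singleton, Measure.pi_singleton]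
  calc ∏ i : s, ν i {x i} ≤ ∏ i : s, ((c i : ℝ≥0∞) * μ i {x i}) :=
        Finset.prod_le_prod' fun i _ => hc i (x i)
    _ = (∏ i ∈ s, c i : ℝ≥0) * ∏ i : s, μ i {x i} := by
        rw [Finset.prod_mul_distrib, ← Finset.prod_coe_sort s c]
        push_cast
        rfl
    _ ≤ C * ∏ i : s, μ i {x i} := by
        gcongr
        exact_mod_cast hC s

variable {μ : Measure Ω} {p : ℝ≥0∞} [Fact (1 ≤ p)]

omit [Fact (1 ≤ p)] in
theorem eLpNorm_comp_le_of_map_le (hp : p ≠ ∞) {φ : Ω → Ω} (hφ : Measurable φ) {C : ℝ≥0}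
    (h : μ.map φ ≤ C • μ) {f : Ω → ℂ} (hf : AEStronglyMeasurable f μ) :
    eLpNorm (f ∘ φ) p μ ≤ (C : ℝ≥0∞) ^ (1 / p).toReal * eLpNorm f p μ := by
  have hac : μ.map φ ≪ μ := (Measure.absolutelyContinuous_of_le h).trans
    (Measure.smul_absolutelyContinuous)
  rw [← eLpNorm_map_measure (hf.mono_ac hac) hφ.aemeasurable, ← smul_eq_mul,
    ← eLpNorm_smul_measure_of_ne_top hp]
  exact eLpNorm_mono_measure f h

theorem exists_isCompositionOperator (hp : p ≠ ∞) {φ : Ω → Ω} (hφ : Measurable φ) {C : ℝ≥0}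
    (h : μ.map φ ≤ C • μ) : ∃ T : Lp ℂ p μ →L[ℂ] Lp ℂ p μ, IsCompositionOperator φ T := by
  have hq : Measure.QuasiMeasurePreserving φ μ μ :=
    ⟨hφ, (Measure.absolutelyContinuous_of_le h).trans Measure.smul_absolutelyContinuous⟩
  have hle : ∀ f : Lp ℂ p μ, eLpNorm ((f : Ω →ₘ[μ] ℂ).compQuasiMeasurePreserving φ hq) p μ ≤
      (C : ℝ≥0∞) ^ (1 / p).toReal * eLpNorm f p μ := fun f => by
    rw [eLpNorm_congr_ae (AEEqFun.coeFn_compQuasiMeasurePreserving _ hq)]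
    exact eLpNorm_comp_le_of_map_le hp hφ h (Lp.aestronglyMeasurable f)
  have hfin : (C : ℝ≥0∞) ^ (1 / p).toReal ≠ ∞ :=
    ENNReal.rpow_ne_top_of_nonneg ENNReal.toReal_nonneg ENNReal.coe_ne_top
  let S : Lp ℂ p μ →ₗ[ℂ] Lp ℂ p μ :=
    { toFun := fun f => ⟨(f : Ω →ₘ[μ] ℂ).compQuasiMeasurePreserving φ hq,
        Lp.mem_Lp_iff_eLpNorm_lt_top.2
        ((hle f).trans_lt (ENNReal.mul_lt_top hfin.lt_top (Lp.eLpNorm_lt_top f)))⟩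
      map_add' := fun f g => by
        ext1
        obtain ⟨⟨f⟩, hf⟩ := f
        obtain ⟨⟨g⟩, hg⟩ := g
        rfl
      map_smul' := fun a f => by
        ext1
        obtain ⟨⟨f⟩, hf⟩ := f
        rfl }
  refine ⟨S.mkContinuous ((C : ℝ≥0∞) ^ (1 / p).toReal).toReal fun f => ?_, hq, fun f => rfl⟩
  rw [Lp.norm_def, Lp.norm_def, ← ENNReal.toReal_mul]
  exact ENNReal.toReal_mono (ENNReal.mul_ne_top hfin (Lp.eLpNorm_ne_top f)) (hle f)

theorem IsCompositionOperator.pow_coeFn {φ : Ω → Ω} {T : Lp ℂ p μ →L[ℂ] Lp ℂ p μ}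
    (hT : IsCompositionOperator φ T) (n : ℕ) (f : Lp ℂ p μ) :
    (T ^ n) f =ᵐ[μ] f ∘ φ^[n] := by
  obtain ⟨hφ, hT⟩ := hT
  induction n with
  | zero => simp
  | succ n ih =>
    rw [pow_succ', mul_apply_eq_comp, Function.iterate_succ]
    have h1 : T ((T ^ n) f) =ᵐ[μ] (T ^ n) f ∘ φ := by
      rw [hT]
      exact AEEqFun.coeFn_compQuasiMeasurePreserving _ hφ
    exact h1.trans (hφ.ae_eq_comp ih)

theorem IsCompositionOperator.norm_pow_le (hp : p ≠ ∞) {φ : Ω → Ω} {T : Lp ℂ p μ →L[ℂ] Lp ℂ p μ}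
    (hT : IsCompositionOperator φ T) {n : ℕ} {C : ℝ≥0} (h : μ.map φ^[n] ≤ C • μ) :
    ‖T ^ n‖ ≤ ((C : ℝ≥0∞) ^ (1 / p).toReal).toReal := by
  refine ContinuousLinearMap.opNorm_le_bound _ ENNReal.toReal_nonneg fun f => ?_
  rw [Lp.norm_def, Lp.norm_def, ← ENNReal.toReal_mul, eLpNorm_congr_ae (hT.pow_coeFn n f)]
  exact ENNReal.toReal_mono (ENNReal.mul_ne_top (ENNReal.rpow_ne_top_of_nonneg
    ENNReal.toReal_nonneg ENNReal.coe_ne_top) (Lp.eLpNorm_ne_top f))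
    (eLpNorm_comp_le_of_map_le hp (hT.choose.measurable.iterate n) h (Lp.aestronglyMeasurable f))

omit [Fact (1 ≤ p)] in
theorem Lp.norm_le_of_ae_bound_of_ae_eq_zero [IsFiniteMeasure μ] {f : Lp ℂ p μ} {K : ℝ}
    (hK : 0 ≤ K) {B : Set Ω} (hB : MeasurableSet B)
    (h : ∀ᵐ x ∂μ, ‖f x‖ ≤ K ∧ (x ∉ B → f x = 0)) : ‖f‖ ≤ K * μ.real B ^ (1 / p.toReal) := by
  have h1 : ‖f‖ ≤ ‖indicatorConstLp p hB (measure_ne_top μ B) (K : ℂ)‖ := by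
    refine Lp.norm_le_norm_of_ae_le ?_
    filter_upwards [h, indicatorConstLp_coeFn (p := p) (hs := hB) (hμs := measure_ne_top μ B)
      (c := (K : ℂ))] with x hx hx'
    rw [hx']
    by_cases hxB : x ∈ B
    · simpa [hxB, abs_of_nonneg hK] using hx.1
    · simp [hx.2 hxB]
  refine h1.trans (norm_indicatorConstLp_le.trans ?_)
  simp [abs_of_nonneg hK]

end CompositionOperators

/-! ### Density of the functions of finitely many coordinates. -/

section CylinderFunctions

variable {X : ℕ → Type*} [∀ i, MeasurableSpace (X i)]

/-- The classes in `L^p` of the bounded measurable functions of the coordinates `0, …, i`. -/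
def cylinderLp (μ : Measure (∀ i, X i)) (p : ℝ≥0∞) (i : ℕ) : AddSubgroup (Lp ℂ p μ) where
  carrier := {f | ∃ g : (∀ i, X i) → ℂ, Measurable g ∧ (∃ K, ∀ x, ‖g x‖ ≤ K) ∧
    DependsOn g (Set.Iic i) ∧ f =ᵐ[μ] g}
  zero_mem' := ⟨0, measurable_const, ⟨0, by simp⟩, fun _ _ _ => rfl, Lp.coeFn_zero _ _ _⟩
  add_mem' := by
    rintro f₁ f₂ ⟨g₁, h₁, ⟨K₁, hK₁⟩, hd₁, he₁⟩ ⟨g₂, h₂, ⟨K₂, hK₂⟩, hd₂, he₂⟩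
    refine ⟨g₁ + g₂, h₁.add h₂, ⟨K₁ + K₂, fun x => (norm_add_le _ _).trans
      (add_le_add (hK₁ x) (hK₂ x))⟩, fun x y h => ?_, (Lp.coeFn_add _ _).trans (he₁.add he₂)⟩
    simp [hd₁ h, hd₂ h]
  neg_mem' := by
    rintro f ⟨g, h, ⟨K, hK⟩, hd, he⟩
    refine ⟨-g, h.neg, ⟨K, by simpa using hK⟩, fun x y h => ?_, (Lp.coeFn_neg _).trans he.neg⟩
    simp [hd h]

theorem cylinderLp_mono (μ : Measure (∀ i, X i)) (p : ℝ≥0∞) : Monotone (cylinderLp μ p) := by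
  rintro i j hij f ⟨g, h, hK, hd, he⟩
  exact ⟨g, h, hK, fun x y hxy => hd fun l hl => hxy l (le_trans hl hij), he⟩

theorem dense_iUnion_cylinderLp (μ : Measure (∀ i, X i)) [IsFiniteMeasure μ] {p : ℝ≥0∞}
    [Fact (1 ≤ p)] (hp : p ≠ ∞) : Dense (⋃ i, (cylinderLp μ p i : Set (Lp ℂ p μ))) := by
  have : Fact (p ≠ ∞) := ⟨hp⟩
  have hdir : Directed (· ≤ ·) (cylinderLp μ p) := (cylinderLp_mono μ p).directed_le
  rw [← AddSubgroup.coe_iSup_of_directed hdir]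
  have h𝒜 : μ.MeasureDense (measurableCylinders X) :=
    Measure.MeasureDense.of_generateFrom_isSetAlgebra_finite μ isSetAlgebra_measurableCylinders
      generateFrom_measurableCylinders.symm
  intro f
  refine Lp.induction hp (motive := fun f => f ∈ closure ((⨆ i, cylinderLp μ p i :
    AddSubgroup (Lp ℂ p μ)) : Set (Lp ℂ p μ))) ?_ ?_ isClosed_closure f
  · intro c s hs hμs
    rw [Lp.simpleFunc.coe_indicatorConst]
    refine closure_mono ?_ (h𝒜.indicatorConstLp_subset_closure p c ⟨s, hs, hμs.ne, rfl⟩)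
    rintro _ ⟨t, ht, hμt, rfl⟩
    have htm := h𝒜.measurable t ht
    simp only [measurableCylinders_nat, Set.mem_iUnion, Set.mem_singleton_iff] at ht
    obtain ⟨N, S, hS, rfl⟩ := ht
    rw [AddSubgroup.coe_iSup_of_directed hdir]
    refine Set.mem_iUnion.2 ⟨N, (cylinder (Finset.Iic N) S).indicator fun _ => c,
      measurable_const.indicator htm, ⟨‖c‖, fun x => norm_indicator_le_norm_self _ _⟩,
      fun x y h => ?_, indicatorConstLp_coeFn⟩
    have : x ∈ cylinder (Finset.Iic N) S ↔ y ∈ cylinder (Finset.Iic N) S := by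
      rw [mem_cylinder, mem_cylinder]
      have : (Finset.Iic N).restrict x = (Finset.Iic N).restrict y := by
        ext i
        exact h i (Finset.mem_Iic.1 i.2)
      rw [this]
    by_cases hx : x ∈ cylinder (Finset.Iic N) S
    · rw [Set.indicator_of_mem hx, Set.indicator_of_mem (this.1 hx)]
    · rw [Set.indicator_of_notMem hx, Set.indicator_of_notMem (fun h => hx (this.2 h))]
  · intro f g hf hg _ h1 h2
    exact (AddSubgroup.topologicalClosure _).add_mem h1 h2

end CylinderFunctions

/-! ### Geometric weights on a finite cyclic group. -/

section GeometricMeasure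

open scoped NNReal

variable {M : ℕ}

theorem ZMod.natAbs_valMinAbs_natCast_le [NeZero M] (n : ℕ) :
    ((n : ZMod M)).valMinAbs.natAbs ≤ n := by
  rw [ZMod.valMinAbs_natAbs_eq_min]
  exact (min_le_left _ _).trans (by rw [ZMod.val_natCast]; exact Nat.mod_le _ _)

theorem ZMod.natAbs_valMinAbs_add_natCast_le [NeZero M] (y : ZMod M) (n : ℕ) :
    (y + (n : ZMod M)).valMinAbs.natAbs ≤ y.valMinAbs.natAbs + n :=
  ((ZMod.natAbs_valMinAbs_add_le y n).trans (Int.natAbs_add_le _ _)).trans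
    (Nat.add_le_add_left (natAbs_valMinAbs_natCast_le n) _)

theorem ZMod.natAbs_valMinAbs_natCast_le_add [NeZero M] (y : ZMod M) (n : ℕ) :
    ((n : ZMod M)).valMinAbs.natAbs ≤ (y + (n : ZMod M)).valMinAbs.natAbs + y.valMinAbs.natAbs := by
  have h := (ZMod.natAbs_valMinAbs_add_le (y + (n : ZMod M)) (-y)).trans (Int.natAbs_add_le _ _)
  rwa [add_neg_cancel_comm, ZMod.natAbs_valMinAbs_neg] at h

/-- The weight of `y : ℤ/Mℤ` decreases geometrically with the distance from `y` to `0`. -/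
noncomputable def circularWeight (M : ℕ) (b : ℝ≥0) (y : ZMod M) : ℝ≥0 :=
  b⁻¹ ^ y.valMinAbs.natAbs

theorem circularWeight_pos {b : ℝ≥0} (hb : 1 ≤ b) (y : ZMod M) : 0 < circularWeight M b y :=
  pow_pos (inv_pos.2 (zero_lt_one.trans_le hb)) _

theorem sum_circularWeight_pos [NeZero M] {b : ℝ≥0} (hb : 1 ≤ b) :
    0 < ∑ y, circularWeight M b y :=
  Finset.sum_pos (fun y _ => circularWeight_pos hb y) Finset.univ_nonempty

/-- The probability measure on `ℤ/Mℤ` proportional to `circularWeight M b`. -/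
noncomputable def circularMeasure (M : ℕ) [NeZero M] {b : ℝ≥0} (hb : 1 ≤ b) :
    Measure (ZMod M) :=
  (PMF.ofFintype (fun y => ((circularWeight M b y / ∑ y, circularWeight M b y : ℝ≥0) : ℝ≥0∞)) (by
    rw [← ENNReal.ofNNReal_finsetSum, ← Finset.sum_div, div_self (sum_circularWeight_pos hb).ne']
    rfl)).toMeasure

variable [NeZero M] {b : ℝ≥0} (hb : 1 ≤ b)

instance : IsProbabilityMeasure (circularMeasure M hb) := by
  unfold circularMeasure; infer_instance

theorem circularMeasure_singleton (y : ZMod M) : circularMeasure M hb {y} =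
    ((circularWeight M b y / ∑ y, circularWeight M b y : ℝ≥0) : ℝ≥0∞) := by
  rw [circularMeasure, PMF.toMeasure_apply_singleton _ _ (measurableSet_singleton y)]
  rfl

theorem circularMeasure_singleton_pos (y : ZMod M) : 0 < circularMeasure M hb {y} := by
  rw [circularMeasure_singleton, ENNReal.coe_pos]
  exact div_pos (circularWeight_pos hb y) (sum_circularWeight_pos hb)

/-- By the triangle inequality on the circle, `|y| ≤ |y - n| + n`, so a shift by `n` changes the
exponent by at most `n`; the normalizing constant is unaffected. -/
theorem map_add_circularMeasure_singleton_le (n : ℕ) (y : ZMod M) :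
    (circularMeasure M hb).map (fun x : ZMod M => x + (n : ZMod M)) {y} ≤
      ((b ^ n : ℝ≥0) : ℝ≥0∞) * circularMeasure M hb {y} := by
  rw [Measure.map_apply (measurable_of_countable _) (measurableSet_singleton y)]
  have : (fun x : ZMod M => x + (n : ZMod M)) ⁻¹' {y} = {y - (n : ZMod M)} := by
    ext x; simp only [Set.mem_preimage, Set.mem_singleton_iff, eq_sub_iff_add_eq]
  rw [this, circularMeasure_singleton, circularMeasure_singleton]
  norm_cast
  rw [← mul_div_assoc]
  gcongr
  have hb0 : 0 < b := zero_lt_one.trans_le hb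
  have h := ZMod.natAbs_valMinAbs_add_natCast_le (y - (n : ZMod M)) n
  rw [sub_add_cancel] at h
  unfold circularWeight
  calc b⁻¹ ^ (y - (n : ZMod M)).valMinAbs.natAbs
      = b ^ n * b⁻¹ ^ ((y - (n : ZMod M)).valMinAbs.natAbs + n) := by
        rw [pow_add, mul_left_comm, ← mul_pow, mul_inv_cancel₀ hb0.ne', one_pow, mul_one]
    _ ≤ b ^ n * b⁻¹ ^ y.valMinAbs.natAbs := by
        exact mul_le_mul_of_nonneg_left
          (pow_le_pow_of_le_one zero_le (inv_le_one_of_one_le₀ hb) h) zero_le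

/-- At most `M` points lie in the set, each of weight at most `b⁻¹ ^ (2 * r)`, while the residues
`0, …, r - 1` alone contribute at least `r * b⁻¹ ^ r` to the total weight. -/
theorem circularMeasure_real_le {r : ℕ} (hr : 0 < r) (hrM : 2 * r ≤ M) :
    (circularMeasure M hb).real {y | 2 * r ≤ y.valMinAbs.natAbs} ≤ M / r / (b : ℝ) ^ r := by
  classical
  have hb0 : 0 < b := zero_lt_one.trans_le hb
  have hinv : b⁻¹ ≤ 1 := inv_le_one_of_one_le₀ hb
  set W := ∑ y, circularWeight M b y
  set S : Finset (ZMod M) := Finset.univ.filter fun y => 2 * r ≤ y.valMinAbs.natAbs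
  have hS : {y : ZMod M | 2 * r ≤ y.valMinAbs.natAbs} = S := by simp [S]
  have h1 : circularMeasure M hb S = ((∑ y ∈ S, circularWeight M b y / W : ℝ≥0) : ℝ≥0∞) := by
    rw [← sum_measure_singleton, ENNReal.ofNNReal_finsetSum]
    exact Finset.sum_congr rfl fun y _ => circularMeasure_singleton hb y
  have h2 : ∑ y ∈ S, circularWeight M b y ≤ M * b⁻¹ ^ (2 * r) := by
    calc _ ≤ ∑ y ∈ S, b⁻¹ ^ (2 * r) := Finset.sum_le_sum fun y hy =>
          pow_le_pow_of_le_one zero_le hinv (Finset.mem_filter.1 hy).2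
      _ = S.card * b⁻¹ ^ (2 * r) := by simp
      _ ≤ M * b⁻¹ ^ (2 * r) := by
          gcongr
          simpa [ZMod.card] using S.card_le_univ
  have h3 : r * b⁻¹ ^ r ≤ W := by
    have hinj : Set.InjOn (fun n : ℕ => (n : ZMod M)) (Finset.range r) := by
      intro x hx y hy hxy
      simp only [Finset.coe_range, Set.mem_Iio] at hx hy
      have := (ZMod.natCast_eq_natCast_iff' x y M).1 hxy
      rwa [Nat.mod_eq_of_lt (by omega), Nat.mod_eq_of_lt (by omega)] at this
    calc (r : ℝ≥0) * b⁻¹ ^ r = ∑ n ∈ Finset.range r, b⁻¹ ^ r := by simp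
      _ ≤ ∑ n ∈ Finset.range r, circularWeight M b n := Finset.sum_le_sum fun n hn =>
          pow_le_pow_of_le_one zero_le hinv
            ((ZMod.natAbs_valMinAbs_natCast_le n).trans (Finset.mem_range.1 hn).le)
      _ = ∑ y ∈ (Finset.range r).image (fun n : ℕ => (n : ZMod M)), circularWeight M b y :=
          (Finset.sum_image hinj).symm
      _ ≤ W := Finset.sum_le_univ_sum_of_nonneg fun y => zero_le
  have hr0 : (0 : ℝ≥0) < r := by exact_mod_cast hr
  have hW : 0 < W := sum_circularWeight_pos hb
  rw [hS, measureReal_def, h1, ENNReal.coe_toReal, ← Finset.sum_div]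
  have h4 : (∑ y ∈ S, circularWeight M b y) / W ≤ M / r / b ^ r := by
    rw [div_le_iff₀ hW]
    calc _ ≤ M * b⁻¹ ^ (2 * r) := h2
      _ = M / r / b ^ r * (r * b⁻¹ ^ r) := by
          rw [two_mul, pow_add, inv_pow]
          field_simp
      _ ≤ _ := by gcongr
  exact_mod_cast h4

theorem circularMeasure_one_singleton_le (hb1 : b = 1) (hM : 2 ≤ M) (y : ZMod M) :
    circularMeasure M hb {y} ≤ 2⁻¹ := by
  subst hb1
  rw [circularMeasure_singleton]
  have h : circularWeight M 1 y / ∑ y, circularWeight M 1 y ≤ 2⁻¹ := by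
    simp only [circularWeight, inv_one, one_pow, Finset.sum_const, Finset.card_univ, ZMod.card,
      nsmul_eq_mul, mul_one, one_div]
    gcongr
    exact_mod_cast hM
  calc _ ≤ ((2⁻¹ : ℝ≥0) : ℝ≥0∞) := by exact_mod_cast h
    _ = 2⁻¹ := by simp

end GeometricMeasure

/-! ### Summable parameters that stay large against an unbounded sequence. -/

section Sequences

theorem exists_summable_of_unbounded {a : ℕ → ℝ} (ha : ∀ (R : ℝ) (N : ℕ), ∃ l ≥ N, R ≤ a l) :
    ∃ g : ℕ → ℝ, (∀ i, 0 ≤ g i) ∧ Summable g ∧ {i | g i = 0}.Infinite ∧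
      ∀ (R : ℝ) (N : ℕ), ∃ l ≥ N, R ≤ g l * a l := by
  choose f hf hfa using ha
  -- At `l k`, `a` is at least `4 ^ k` and `g` will be `2 ^ (-k)`, so the product is at least `2 ^
  -- k`. Gaps of at least `2` leave each `l k + 1` free for a zero of `g`.
  let l : ℕ → ℕ := fun k => Nat.rec (f 1 0) (fun k lk => f (4 ^ (k + 1)) (lk + 2)) k
  have hl : ∀ k, l k + 2 ≤ l (k + 1) := fun k => hf _ _
  have hla : ∀ k, (4 : ℝ) ^ k ≤ a (l k) := by
    rintro (_ | k)
    · rw [pow_zero]; exact hfa 1 0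
    · exact hfa _ _
  have hmono : StrictMono l := strictMono_nat_of_lt_succ fun k => by have := hl k; omega
  have hg : Summable (Function.extend l (fun k => (1 / 2 : ℝ) ^ k) 0) :=
    (hasSum_extend_zero hmono.injective).2 summable_geometric_two.hasSum |>.summable
  refine ⟨Function.extend l (fun k => (1 / 2) ^ k) 0, fun i => ?_, hg, ?_, fun R N => ?_⟩
  · rcases em (∃ k, l k = i) with ⟨k, rfl⟩ | h
    · rw [hmono.injective.extend_apply]
      positivity
    · rw [Function.extend_apply' _ _ _ h]
      rfl
  · refine Set.infinite_of_forall_exists_gt fun N => ⟨l N + 1, ?_, ?_⟩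
    · refine Function.extend_apply' _ _ _ ?_
      rintro ⟨k, hk⟩
      rcases lt_or_ge N k with h | h
      · have := hmono.monotone (Nat.succ_le_of_lt h)
        have := hl N
        simp only [Nat.succ_eq_add_one] at *
        omega
      · have := hmono.monotone h; omega
    · exact Nat.lt_succ_of_le (hmono.id_le N)
  · obtain ⟨k, hk⟩ := pow_unbounded_of_one_lt R (show (1 : ℝ) < 2 by norm_num)
    refine ⟨l (max k N), (le_max_right _ _).trans (hmono.id_le _), ?_⟩
    rw [hmono.injective.extend_apply]
    calc R ≤ 2 ^ k := hk.le
      _ ≤ 2 ^ (max k N) := pow_le_pow_right₀ (by norm_num) (le_max_left _ _)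
      _ = (1 / 2) ^ (max k N) * 4 ^ (max k N) := by rw [← mul_pow]; norm_num
      _ ≤ _ := by gcongr; exact hla _

theorem exists_ge_of_not_bddAbove_range {u : ℕ → ℝ} (h : ¬ BddAbove (Set.range u)) (R : ℝ)
    (N : ℕ) : ∃ l ≥ N, R ≤ u l := by
  by_contra! hlt
  refine h (((Set.finite_lt_nat N).image u).bddAbove.union (bddAbove_Iic (a := R)) |>.mono ?_)
  rintro _ ⟨i, rfl⟩
  rcases lt_or_ge i N with hi | hi
  · exact Or.inl ⟨i, hi, rfl⟩
  · exact Or.inr (hlt i hi).le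

theorem Finset.prod_one_add_le_exp_tsum {g : ℕ → ℝ} (hg : ∀ i, 0 ≤ g i) (hs : Summable g)
    {c : ℕ → NNReal} (hc : ∀ i, (c i : ℝ) ≤ Real.exp (g i)) (s : Finset ℕ) :
    ∏ i ∈ s, c i ≤ (Real.exp (∑' i, g i)).toNNReal := by
  refine NNReal.le_toNNReal_of_coe_le ?_
  push_cast
  calc ∏ i ∈ s, (c i : ℝ) ≤ ∏ i ∈ s, Real.exp (g i) :=
        Finset.prod_le_prod (fun i _ => NNReal.coe_nonneg _) fun i _ => hc i
    _ = Real.exp (∑ i ∈ s, g i) := (Real.exp_sum s g).symm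
    _ ≤ _ := Real.exp_le_exp.2 (hs.sum_le_tsum s fun i _ => hg i)

end Sequences

/-! ### The diagonal translation on the product space. -/

section DiagonalTranslation

open scoped NNReal

variable {m : ℕ → ℕ}

theorem measurable_diagonalTranslation : Measurable (diagonalTranslation m) :=
  measurable_pi_lambda _ fun i => (measurable_from_top (f := fun y : ZMod (m i) => y + 1)).comp
    (measurable_pi_apply i)

theorem diagonalTranslation_iterate_apply (n : ℕ) (x : ∀ i, ZMod (m i)) (i : ℕ) :
    (diagonalTranslation m)^[n] x i = x i + (n : ZMod (m i)) := by
  induction n with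
  | zero => simp
  | succ n ih =>
    rw [Function.iterate_succ_apply']
    change (diagonalTranslation m)^[n] x i + 1 = _
    rw [ih]
    push_cast
    ring

theorem DependsOn.diagonalTranslation_iterate_eq {E : Type*} (hdvd : ∀ i j, i ≤ j → m i ∣ m j)
    {g : (∀ i, ZMod (m i)) → E} {i n : ℕ} (hg : DependsOn g (Set.Iic i)) (hn : m i ∣ n)
    (x : ∀ i, ZMod (m i)) : g ((diagonalTranslation m)^[n] x) = g x := by
  refine hg fun l hl => ?_
  rw [diagonalTranslation_iterate_apply,
    (ZMod.natCast_eq_zero_iff n (m l)).2 ((hdvd l i hl).trans hn), add_zero]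

variable [∀ i, NeZero (m i)]

theorem map_diagonalTranslation_iterate_le {μ : ∀ i, Measure (ZMod (m i))}
    [∀ i, IsProbabilityMeasure (μ i)] {n : ℕ} {c : ℕ → ℝ≥0} {C : ℝ≥0}
    (hc : ∀ i y, (μ i).map (fun x => x + (n : ZMod (m i))) {y} ≤ c i * μ i {y})
    (hC : ∀ s : Finset ℕ, ∏ i ∈ s, c i ≤ C) :
    (Measure.infinitePi μ).map (diagonalTranslation m)^[n] ≤ C • Measure.infinitePi μ := by
  have h : (diagonalTranslation m)^[n] = fun x i => x i + (n : ZMod (m i)) := by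
    ext x i
    exact diagonalTranslation_iterate_apply n x i
  have hmeas : ∀ i, Measurable fun x : ZMod (m i) => x + (n : ZMod (m i)) :=
    fun i => measurable_of_countable _
  have : ∀ i, IsProbabilityMeasure ((μ i).map fun x => x + (n : ZMod (m i))) :=
    fun i => Measure.isProbabilityMeasure_map (hmeas i).aemeasurable
  rw [h, Measure.infinitePi_map_pi μ hmeas]
  exact Measure.infinitePi_le_smul hc hC

/-- A factor with `b i = 1` is uniform, so its points have mass at most `1 / 2`; infinitely many
such factors leave no atom. -/
theorem infinitePi_circularMeasure_singleton (hm : ∀ i, 2 ≤ m i) {b : ℕ → ℝ≥0} (hb : ∀ i, 1 ≤ b i)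
    (hinf : {i | b i = 1}.Infinite) (x : ∀ i, ZMod (m i)) :
    Measure.infinitePi (fun i => circularMeasure (m i) (hb i)) {x} = 0 := by
  refine le_antisymm (ge_of_tendsto' (ENNReal.tendsto_pow_atTop_nhds_zero_of_lt_one
    (r := 2⁻¹) (by simp)) fun n => ?_) zero_le
  obtain ⟨s, hs, rfl⟩ := hinf.exists_subset_card_eq n
  calc _ ≤ Measure.infinitePi (fun i => circularMeasure (m i) (hb i))
        ((s : Set ℕ).pi fun i => {x i}) := measure_mono (by simp)
    _ = ∏ i ∈ s, circularMeasure (m i) (hb i) {x i} :=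
        Measure.infinitePi_pi _ fun i _ => measurableSet_singleton _
    _ ≤ ∏ i ∈ s, 2⁻¹ :=
        Finset.prod_le_prod' fun i hi => circularMeasure_one_singleton_le (hb i) (hs hi) (hm i) _
    _ = _ := by simp

variable {p : ℝ≥0∞} [Fact (1 ≤ p)]

omit [∀ i, NeZero (m i)] in
theorem IsCompositionOperator.pow_apply_of_mem_cylinderLp (hdvd : ∀ i j, i ≤ j → m i ∣ m j)
    {μ : Measure (∀ i, ZMod (m i))} {T : Lp ℂ p μ →L[ℂ] Lp ℂ p μ}
    (hT : IsCompositionOperator (diagonalTranslation m) T) {i : ℕ} {f : Lp ℂ p μ}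
    (hf : f ∈ cylinderLp μ p i) : (T ^ m i) f = f := by
  obtain ⟨g, -, -, hg, he⟩ := hf
  ext1
  have h := (hT.choose.iterate (m i)).ae_eq_comp he
  filter_upwards [hT.pow_coeFn (m i) f, he, h] with x h1 h2 h3
  rw [h1, h3, h2]
  exact hg.diagonalTranslation_iterate_eq hdvd dvd_rfl x

/-- Condition `hconc` supplies a coordinate `l` whose circle is long compared with the period `m i`
and whose mass concentrates near `0` at the scale `m l`. The vector `z` is `f` cut off to the points
far from `0` in that coordinate. -/
theorem isFrequentlyHypercyclic_diagonalTranslation (hm : ∀ i, 2 ≤ m i)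
    (hdvd : ∀ i j, i ≤ j → m i ∣ m j)
    {b : ℕ → ℝ≥0} (hb : ∀ i, 1 ≤ b i)
    (hconc : ∀ R i : ℕ, ∃ l ≥ i, R * m i ≤ m l ∧ (R : ℝ) ≤ (b l - 1) * m l) (hp : p ≠ ∞)
    {μ : Measure (∀ i, ZMod (m i))}
    (hμ : μ = Measure.infinitePi fun i => circularMeasure (m i) (hb i))
    {T : Lp ℂ p μ →L[ℂ] Lp ℂ p μ}
    (hT : IsCompositionOperator (diagonalTranslation m) T) : IsFrequentlyHypercyclic T := by
  have : IsProbabilityMeasure μ := hμ ▸ inferInstance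
  have : Fact (p ≠ ∞) := ⟨hp⟩
  refine isFrequentlyHypercyclic_of_periodic_approximation T m (fun i => by have := hm i; omega)
    hdvd (cylinderLp μ p) (cylinderLp_mono μ p)
    (fun i f hf => hT.pow_apply_of_mem_cylinderLp hdvd hf)
    (dense_iUnion_cylinderLp μ hp) 24 ?_
  rintro i f ⟨g, hgm, ⟨K, hK⟩, hg, hfg⟩ ε hε
  have hK0 : 0 ≤ K := (norm_nonneg _).trans (hK 0)
  have hp0 : 0 < p.toReal := ENNReal.toReal_pos
    (zero_lt_one.trans_le (Fact.out : (1 : ℝ≥0∞) ≤ p)).ne' hp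
  -- `576 = 24 * 24`: below, `m l / r ≤ 24`, and Bernoulli's inequality gives `b l ^ r ≥ R / 24`.
  obtain ⟨R, hRε, hR⟩ : ∃ R : ℕ, K * (576 / (R : ℝ)) ^ (1 / p.toReal) ≤ ε ∧ 12 ≤ R := by
    have h1 : Tendsto (fun R : ℕ => K * (576 / (R : ℝ)) ^ (1 / p.toReal)) atTop (𝓝 0) := by
      have h2 := ((tendsto_const_div_atTop_nhds_zero_nat (576 : ℝ)).rpow_const
        (p := 1 / p.toReal) (Or.inr (by positivity))).const_mul K
      rwa [Real.zero_rpow (by positivity), mul_zero] at h2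
    exact ((h1.eventually_le_const hε).and (eventually_ge_atTop 12)).exists
  obtain ⟨l, hil, hRm, hRb⟩ := hconc R i
  obtain ⟨Q, hQ⟩ := hdvd i l hil
  have hmi : 0 < m i := by have := hm i; omega
  have hQ12 : 12 ≤ Q := by
    rw [hQ, mul_comm] at hRm
    exact hR.trans (Nat.le_of_mul_le_mul_left hRm hmi)
  -- A multiple of `m i` between `m l / 24` and `m l / 12`; divisibility makes `T ^ (6 * r)` fix
  -- `f`.
  set r := m i * (Q / 12) with hr
  have hr0 : 0 < r := Nat.mul_pos hmi (Nat.div_pos hQ12 (by norm_num))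
  have hrm : 12 * r ≤ m l := by
    rw [hQ, hr, mul_left_comm]
    exact Nat.mul_le_mul_left _ (Nat.mul_div_le Q 12)
  have hmr : m l ≤ 24 * r := by
    rw [hQ, hr, mul_left_comm]
    exact Nat.mul_le_mul_left _ (by omega)
  have hmeas : ∀ s : ℕ, MeasurableSet {x : ∀ i, ZMod (m i) | s ≤ (x l).valMinAbs.natAbs} :=
    fun s => measurableSet_le measurable_const
      ((measurable_of_countable fun y : ZMod (m l) => y.valMinAbs.natAbs).comp
        (measurable_pi_apply l))
  set B : Set (∀ i, ZMod (m i)) := {x | 2 * r ≤ (x l).valMinAbs.natAbs} with hB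
  have hBm : MeasurableSet B := hmeas _
  have hμB : μ.real B ≤ 576 / R := by
    have h1 : μ.real B = (circularMeasure (m l) (hb l)).real
        {y | 2 * r ≤ y.valMinAbs.natAbs} := by
      rw [hμ, ← Measure.infinitePi_map_eval (fun i => circularMeasure (m i) (hb i)) l,
        map_measureReal_apply (measurable_pi_apply l) (Set.to_countable _).measurableSet]
      rfl
    rw [h1]
    refine (circularMeasure_real_le (hb l) hr0 (by omega)).trans ?_
    have hr0' : (0 : ℝ) < r := by exact_mod_cast hr0
    have hR0' : (0 : ℝ) < R := by exact_mod_cast (by omega : 0 < R)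
    have hmr' : (m l : ℝ) ≤ 24 * r := by exact_mod_cast hmr
    have hb1 : (1 : ℝ) ≤ b l := by exact_mod_cast hb l
    have h2 : (R : ℝ) / 24 ≤ (b l : ℝ) ^ r := by
      have h3 := one_add_mul_le_pow (a := (b l : ℝ) - 1) (by linarith) r
      rw [add_sub_cancel] at h3
      nlinarith
    rw [div_div, div_le_div_iff₀ (by positivity) hR0']
    nlinarith
  have hsmall : ∀ h : Lp ℂ p μ, (∀ᵐ x ∂μ, ‖h x‖ ≤ K ∧ (x ∉ B → h x = 0)) → ‖h‖ ≤ ε := by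
    intro h hh
    refine (Lp.norm_le_of_ae_bound_of_ae_eq_zero hK0 hBm hh).trans (le_trans ?_ hRε)
    gcongr
  set A : Set (∀ i, ZMod (m i)) := {x | 3 * r ≤ (x l).valMinAbs.natAbs} with hA
  have hAm : MeasurableSet A := hmeas _
  have hAgm : Measurable (A.indicator g) := hgm.indicator hAm
  have hAgK : ∀ x, ‖A.indicator g x‖ ≤ K := fun x => (norm_indicator_le_norm_self _ _).trans (hK x)
  have hz : MemLp (A.indicator g) p μ :=
    MemLp.of_bound hAgm.aestronglyMeasurable K (ae_of_all _ hAgK)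
  have hzT : ∀ n, (T ^ n) (hz.toLp _) =ᵐ[μ]
      fun x => A.indicator g ((diagonalTranslation m)^[n] x) :=
    fun n => (hT.pow_coeFn n _).trans ((hT.choose.iterate n).ae_eq_comp hz.coeFn_toLp)
  have hfT : ∀ n, (T ^ n) f =ᵐ[μ] fun x => g ((diagonalTranslation m)^[n] x) :=
    fun n => (hT.pow_coeFn n _).trans ((hT.choose.iterate n).ae_eq_comp hfg)
  -- For `t < r`, a point outside `B` is moved to distance less than `3 * r`, so misses `A`. After a
  -- further shift by `6 * r` it is at distance more than `3 * r`, so lies in `A`. Hence both errors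
  -- are supported in `B`.
  refine ⟨l, hil, hz.toLp _, ⟨A.indicator g, hAgm, ⟨K, hAgK⟩, fun x y hxy => ?_, hz.coeFn_toLp⟩,
    6 * r, r, Dvd.dvd.mul_left (dvd_mul_right _ _) _, dvd_mul_right _ _, hr0, by omega, by omega,
    hmr, fun t ht => hsmall _ ?_, fun t ht => hsmall _ ?_⟩
  · have hxl : x l = y l := hxy l (Set.mem_Iic.2 le_rfl)
    have hgxy : g x = g y := hg fun j hj => hxy j (le_trans hj hil)
    classical
    simp only [Set.indicator_apply, hA, Set.mem_ofPred_eq, hxl, hgxy]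
  · filter_upwards [hzT t] with x hx
    rw [hx]
    refine ⟨hAgK _, fun hxB => Set.indicator_of_notMem (fun hxA => hxB ?_) _⟩
    simp only [hA, hB, Set.mem_ofPred_eq, diagonalTranslation_iterate_apply] at hxA ⊢
    have := ZMod.natAbs_valMinAbs_add_natCast_le (x l) t
    omega
  · filter_upwards [hzT (6 * r + t), hfT t, Lp.coeFn_sub ((T ^ (6 * r + t)) (hz.toLp _)) ((T ^ t) f)]
      with x h1 h2 h3
    have h4 : g ((diagonalTranslation m)^[6 * r + t] x) = g ((diagonalTranslation m)^[t] x) := by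
      rw [Function.iterate_add_apply]
      exact hg.diagonalTranslation_iterate_eq hdvd (Dvd.dvd.mul_left (dvd_mul_right _ _) _) _
    rw [h3, Pi.sub_apply, h1, h2]
    by_cases hxA : (diagonalTranslation m)^[6 * r + t] x ∈ A
    · rw [Set.indicator_of_mem hxA, h4, sub_self]
      exact ⟨by simpa using hK0, fun _ => rfl⟩
    · rw [Set.indicator_of_notMem hxA, zero_sub, norm_neg]
      refine ⟨hK _, fun hxB => absurd ?_ hxA⟩
      simp only [hA, hB, Set.mem_ofPred_eq, diagonalTranslation_iterate_apply, not_le] at hxB ⊢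
      -- As `12 * r ≤ m l`, the residue of `6 * r` is at distance exactly `6 * r` from `0`.
      have h5 := ZMod.natAbs_valMinAbs_natCast_le_add (x l + (t : ZMod (m l))) (6 * r)
      have h6 := ZMod.natAbs_valMinAbs_add_natCast_le (x l) t
      rw [ZMod.valMinAbs_natCast_of_le_half (by omega), Int.natAbs_natCast] at h5
      rw [Nat.cast_add, add_comm ((6 * r : ℕ) : ZMod (m l)), ← add_assoc]
      omega

end DiagonalTranslation

/-! ### The choice of the parameters `b i` in the two cases. -/

theorem mainTheorem12 (m : ℕ → ℕ) (hm : ∀ i, 2 ≤ m i) (hdvd : ∀ i, m i ∣ m (i + 1)) :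
    (Tendsto m atTop atTop →
      ∃ (μ : ∀ i, Measure (ZMod (m i))) (_ : ∀ i, IsProbabilityMeasure (μ i)),
        (∀ i j, 0 < μ i {j}) ∧
        (∀ x, Measure.infinitePi μ {x} = 0) ∧
        ∀ (p : ℝ≥0∞) [Fact (1 ≤ p)], p ≠ ∞ →
          ∃ T : Lp ℂ p (Measure.infinitePi μ) →L[ℂ] Lp ℂ p (Measure.infinitePi μ),
            IsCompositionOperator (diagonalTranslation m) T ∧
            IsFrequentlyHypercyclic T) ∧
    (¬ BddAbove (Set.range fun i : ℕ => (m (i + 1) : ℝ) / (m i : ℝ)) →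
      ∃ (μ : ∀ i, Measure (ZMod (m i))) (_ : ∀ i, IsProbabilityMeasure (μ i)),
        (∀ i j, 0 < μ i {j}) ∧
        (∀ x, Measure.infinitePi μ {x} = 0) ∧
        ∀ (p : ℝ≥0∞) [Fact (1 ≤ p)], p ≠ ∞ →
          ∃ T : Lp ℂ p (Measure.infinitePi μ) →L[ℂ] Lp ℂ p (Measure.infinitePi μ),
            IsCompositionOperator (diagonalTranslation m) T ∧
            IsFrequentlyHypercyclic T ∧
            IsTopologicallyRigidAlong T m ∧
            IsChaotic T ∧
            ¬ IsTopologicallyMixing T) := by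
  have hdvd' : ∀ i j, i ≤ j → m i ∣ m j := fun i j hij =>
    Nat.le_induction dvd_rfl (fun k _ h => h.trans (hdvd k)) j hij
  have hne : ∀ i, NeZero (m i) := fun i => ⟨by have := hm i; omega⟩
  have hm0 : ∀ i, (0 : ℝ) < m i := fun i => by exact_mod_cast (by have := hm i; omega : 0 < m i)
  have hmono : Monotone m := fun i j hij => Nat.le_of_dvd (by have := hm j; omega) (hdvd' i j hij)
  have hconc : Tendsto m atTop atTop → ∀ b : ℕ → NNReal,
      (∀ (R : ℝ) (N : ℕ), ∃ l ≥ N, R ≤ (b l - 1) * m l) →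
      ∀ R i : ℕ, ∃ l ≥ i, R * m i ≤ m l ∧ (R : ℝ) ≤ (b l - 1) * m l := fun htop b h R i => by
    obtain ⟨N, hN⟩ := eventually_atTop.1 (htop.eventually_ge_atTop (R * m i))
    obtain ⟨l, hl, hRl⟩ := h R (max N i)
    exact ⟨l, (le_max_right _ _).trans hl, hN l ((le_max_left _ _).trans hl), hRl⟩
  constructor
  · intro htop
    obtain ⟨g, hg0, hgs, hginf, hg⟩ := exists_summable_of_unbounded (a := fun i => (m i : ℝ))
      fun R N => (((tendsto_natCast_atTop_atTop (R := ℝ)).comp htop).eventually_ge_atTop R |>.and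
        (eventually_ge_atTop N)).exists.imp fun l h => ⟨h.2, h.1⟩
    set b : ℕ → NNReal := fun i => 1 + (g i).toNNReal with hbdef
    have hbr : ∀ i, (b i : ℝ) = 1 + g i := fun i => by simp [hbdef, hg0 i]
    have hb : ∀ i, 1 ≤ b i := fun i => le_self_add
    refine ⟨fun i => circularMeasure (m i) (hb i), fun i => inferInstance,
      fun i j => circularMeasure_singleton_pos (hb i) j,
      infinitePi_circularMeasure_singleton hm hb (hginf.mono fun i hi => ?_), fun p _ hp => ?_⟩
    · simp only [Set.mem_ofPred_eq] at hi ⊢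
      simp [hbdef, hi]
    obtain ⟨T, hT⟩ := exists_isCompositionOperator (p := p) hp measurable_diagonalTranslation
      (map_diagonalTranslation_iterate_le (n := 1) (c := b)
        (μ := fun i => circularMeasure (m i) (hb i))
        (fun i y => by simpa using map_add_circularMeasure_singleton_le (hb i) 1 y)
        (Finset.prod_one_add_le_exp_tsum hg0 hgs fun i => by
          rw [hbr, add_comm]; exact Real.add_one_le_exp _))
    refine ⟨T, hT, isFrequentlyHypercyclic_diagonalTranslation hm hdvd' hb
      (hconc htop b fun R N => ?_) hp rfl hT⟩
    simpa [hbr] using hg R N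
  · intro hbdd
    have hunb := exists_ge_of_not_bddAbove_range hbdd
    have htop : Tendsto m atTop atTop := by
      refine tendsto_atTop_atTop_of_monotone hmono fun R => ?_
      obtain ⟨l, -, hl⟩ := hunb R 0
      refine ⟨l + 1, ?_⟩
      have h1 : (1 : ℝ) ≤ m l := by exact_mod_cast (by have := hm l; omega : 1 ≤ m l)
      have h2 : (m (l + 1) : ℝ) / m l ≤ m (l + 1) := div_le_self (hm0 _).le h1
      exact_mod_cast hl.trans h2
    -- At `i = 0` the index `i - 1` is again `0`; this is harmless, since translation by any `m k`
    -- fixes the coordinate `0` and one step only needs `m (i - 1) ≥ 1`.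
    obtain ⟨g, hg0, hgs, hginf, hg⟩ := exists_summable_of_unbounded
      (a := fun i => (m i : ℝ) / m (i - 1)) fun R N => by
        obtain ⟨l, hl, hRl⟩ := hunb R N
        exact ⟨l + 1, by omega, hRl⟩
    have he0 : ∀ i, 0 ≤ g i / m (i - 1) := fun i => div_nonneg (hg0 i) (hm0 _).le
    set b : ℕ → NNReal := fun i => 1 + (g i / m (i - 1)).toNNReal with hbdef
    have hbr : ∀ i, (b i : ℝ) = 1 + g i / m (i - 1) := fun i => by simp [hbdef, he0 i]
    have hb : ∀ i, 1 ≤ b i := fun i => le_self_add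
    set μ : ∀ i, Measure (ZMod (m i)) := fun i => circularMeasure (m i) (hb i) with hμ
    have hmap_one : (Measure.infinitePi μ).map (diagonalTranslation m)^[1] ≤
        (Real.exp (∑' i, g i)).toNNReal • Measure.infinitePi μ := by
      refine map_diagonalTranslation_iterate_le (c := b)
        (fun i y => by simpa using map_add_circularMeasure_singleton_le (hb i) 1 y)
        (Finset.prod_one_add_le_exp_tsum hg0 hgs fun i => ?_)
      rw [hbr, add_comm]
      have h1 : (1 : ℝ) ≤ m (i - 1) := by exact_mod_cast (by have := hm (i - 1); omega)
      exact (add_le_add_left (div_le_self (hg0 i) h1) 1).trans (Real.add_one_le_exp _)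
    have hmap : ∀ k, (Measure.infinitePi μ).map (diagonalTranslation m)^[m k] ≤
        (Real.exp (∑' i, g i)).toNNReal • Measure.infinitePi μ := fun k => by
      -- Coordinates up to `k` do not move. For `i > k`, `m k ≤ m (i - 1)` cancels the denominator
      -- of `b i - 1`, which makes the bound independent of `k`.
      refine map_diagonalTranslation_iterate_le (c := fun i => if i ≤ k then 1 else b i ^ m k)
        (fun i y => ?_) (Finset.prod_one_add_le_exp_tsum hg0 hgs fun i => ?_)
      · split_ifs with hik
        · simp [(ZMod.natCast_eq_zero_iff (m k) (m i)).2 (hdvd' i k hik)]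
        · exact map_add_circularMeasure_singleton_le (hb i) (m k) y
      · split_ifs with hik
        · simpa using hg0 i
        · push_cast
          have hk : (m k : ℝ) ≤ m (i - 1) := by exact_mod_cast hmono (by omega : k ≤ i - 1)
          calc (b i : ℝ) ^ m k ≤ Real.exp (g i / m (i - 1)) ^ m k := by
                gcongr
                rw [hbr, add_comm]
                exact Real.add_one_le_exp _
            _ = Real.exp (g i * (m k / m (i - 1))) := by
                rw [← Real.exp_nat_mul]
                ring_nf
            _ ≤ Real.exp (g i) := Real.exp_le_exp.2
                (mul_le_of_le_one_right (hg0 i) (div_le_one_of_le₀ hk (hm0 _).le))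
    refine ⟨μ, fun i => inferInstance, fun i j => circularMeasure_singleton_pos (hb i) j,
      infinitePi_circularMeasure_singleton hm hb (hginf.mono fun i hi => ?_), fun p _ hp => ?_⟩
    · simp only [Set.mem_ofPred_eq] at hi ⊢
      simp [hbdef, hi]
    obtain ⟨T, hT⟩ := exists_isCompositionOperator (p := p) hp measurable_diagonalTranslation
      hmap_one
    have hfhc := isFrequentlyHypercyclic_diagonalTranslation hm hdvd' hb
      (hconc htop b fun R N => by
        simpa [hbr, mul_comm_div, div_mul_eq_mul_div, mul_div_assoc] using hg R N) hp rfl hT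
    have hnorm := fun k => hT.norm_pow_le hp (hmap k)
    have hdense := dense_iUnion_cylinderLp (Measure.infinitePi μ) hp
    have hnt : Nontrivial (Lp ℂ p (Measure.infinitePi μ)) := by
      refine nontrivial_of_ne (indicatorConstLp p MeasurableSet.univ
        (measure_ne_top (Measure.infinitePi μ) _) (1 : ℂ)) 0 (norm_ne_zero_iff.1 ?_)
      rw [norm_indicatorConstLp (zero_lt_one.trans_le (Fact.out : (1 : ℝ≥0∞) ≤ p)).ne' hp]
      simp
    refine ⟨T, hT, hfhc, isTopologicallyRigidAlong_of_dense hnorm hdense fun f hf => ?_,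
      ⟨hfhc.isHypercyclic, hdense.mono fun f hf => ?_⟩,
      not_isTopologicallyMixing_of_norm_pow_le htop hnorm⟩
    · obtain ⟨i, hi⟩ := Set.mem_iUnion.1 hf
      filter_upwards [eventually_ge_atTop i] with j hj
      exact hT.pow_apply_of_mem_cylinderLp hdvd' (cylinderLp_mono _ _ hj hi)
    · obtain ⟨i, hi⟩ := Set.mem_iUnion.1 hf
      exact ⟨m i, by have := hm i; omega, hT.pow_apply_of_mem_cylinderLp hdvd' hi⟩
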